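/- Conventions. $\log$ is the principal branch and $x^{-s-1}=e^{(-s-1)\log x}$. For $z\in\mathbb C$ put $\{z\}=\tfrac12+\tfrac{i}{2\pi}\log e^{-2\pi i(z-1/2)}$ (so $\{z\}=\{\operatorname{Re}z\}+i\operatorname{Im}z$, extending the usual fractional part). For $x\in\mathbb R$ let $\operatorname{sgn}x=1$ if $x\ge 0$ and $\operatorname{sgn}x=-1$ if $x<0$. For $a,b\in\mathbb C$ and $d>0$ let $$d_+=\begin{cases}-\frac{\operatorname{Im}b}{\operatorname{Im}a},&\operatorname{Im}a\ne0\text{ and }-\frac{\operatorname{Im}b}{\operatorname{Im}a}>d,\\ d,&\text{otherwise,}\end{cases}\qquad d_-=\begin{cases}1,&\operatorname{Im}a=\operatorname{Im}b=0,\\ \operatorname{sgn}(2d_+\operatorname{Im}a+\operatorname{Im}b),&\text{otherwise,}\end{cases}$$ and, for $c\in\mathbb C$, with improper integrals $\int_d^\infty=\lim_{T\to\infty}\int_d^T$, $$I_s(a,b,c,d)=\cos(2\pi c)\int_d^\infty\pi\Bigl(\tfrac12-\{ax+b\}+i(x\operatorname{Im}a+\operatorname{Im}b)\Bigr)x^{-s-1}\,dx-\sin(2\pi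 c)\int_d^\infty\Bigl(\tfrac12\log\bigl(4\sin^2(\pi(ax+b))\bigr)-\pi\,|x\operatorname{Im}a+\operatorname{Im}b|\Bigr)x^{-s-1}\,dx .$$ Corollary 2.3. Call $(a,b,d)$ admissible if $d>0$, $a,b\in\mathbb C$, $a\neq0$, $d_+=d$ and $d_-=1$. Then the following hold. (i) Let $(a,b,d)$ be admissible and $c\in\mathbb C$. If $\operatorname{Re}a\ne0$, then $I_s(a,b,c,d)$ converges for $\operatorname{Re}s>-1$ and has a unique continuation $\widetilde I_s(a,b,c,d)$ that is entire in $s$. If $\operatorname{Re}a=0$, then it converges for $\operatorname{Re}s>0$ and has a unique holomorphic continuation $\widetilde I_s(a,b,c,d)$ to $s\in\mathbb C\setminus\{0\}$. (ii) Let $s\in\mathbb C$, $d>0$ and $\delta>0$. Then $$\widetilde I_s(a,b,\tfrac14,d)-\bigl(-i\,\widetilde I_s(a,b,0,d)\bigr)\longrightarrow 0\qquad\text{as } d\operatorname{Im}a+\operatorname{Im}b\to\infty,$$ where $a,b$ vary so that $(a,b,d)$ is admissible, $|a|\ge\delta$, and $\operatorname{Re}a\neq0$ in case $s=0$. (iii)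 The convergence is exponentially fast: for every $s\in\mathbb C$ and $\delta>0$ there is a constant $C=C(s,\delta)$ such that $$\bigl|\widetilde I_s(a,b,\tfrac14,d)-\bigl(-i\,\widetilde I_s(a,b,0,d)\bigr)\bigr|\le C\,d^{-\operatorname{Re}s}\,e^{-2\pi(d\operatorname{Im}a+\operatorname{Im}b)}$$ for all admissible $(a,b,d)$ with $d|a|\ge\delta$ and $d\operatorname{Im}a+\operatorname{Im}b>0$, where $\operatorname{Re}a\ne0$ in case $s=0$. In words, the log-sine transform deforms into the sawtooth transform. -/

import Mathlib

open Filter Topology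

noncomputable section

namespace AffineMellin

/-- The fractional part on `ℂ`, `{z} = 1/2 + (i/2π) log e^{-2πi(z - 1/2)}`, with the principal branch
of the logarithm; it equals `{Re z} + i Im z`. -/
def frac (z : ℂ) : ℂ :=
  1 / 2 + Complex.I / (2 * Real.pi) *
    Complex.log (Complex.exp (-Complex.I * (2 * Real.pi) * (z - 1 / 2)))

/-- The sign, with value `1` at `0`. -/
def sgn (x : ℝ) : ℝ := if 0 ≤ x then 1 else -1

open Classical in
/-- `d₊`: the zero of `x ↦ x Im a + Im b`, if this zero exists and exceeds `d`, and `d` otherwise. -/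
def dPlus (a b : ℂ) (d : ℝ) : ℝ :=
  if a.im ≠ 0 ∧ d < -b.im / a.im then -b.im / a.im else d

open Classical in
/-- `d₋`: the sign of `x Im a + Im b` for `x > d₊`. -/
def dMinus (a b : ℂ) (d : ℝ) : ℝ :=
  if a.im = 0 ∧ b.im = 0 then 1 else sgn (2 * dPlus a b d * a.im + b.im)

/-- The sawtooth integrand of the transform, evaluated along `x ↦ a x + b`. -/
def sawtooth (a b : ℂ) (x : ℝ) : ℂ :=
  Real.pi * (1 / 2 - frac (a * x + b) + Complex.I * ((a.im * x + b.im : ℝ) : ℂ))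

/-- The log-sine integrand of the transform, evaluated along `x ↦ a x + b`. -/
def logSine (a b : ℂ) (x : ℝ) : ℂ :=
  1 / 2 * Complex.log (4 * Complex.sin (Real.pi * (a * x + b)) ^ 2)
    - ((Real.pi * |a.im * x + b.im| : ℝ) : ℂ)

/-- The integral `I_s(a,b,c,d)` with the upper limit `∞` replaced by `T`. -/
def truncI (s a b c : ℂ) (d T : ℝ) : ℂ :=
  Complex.cos (2 * Real.pi * c) * (∫ x in d..T, sawtooth a b x * (x : ℂ) ^ (-s - 1))
    - Complex.sin (2 * Real.pi * c) * (∫ x in d..T, logSine a b x * (x : ℂ) ^ (-s - 1))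

/-- `I_s(a,b,c,d) = v`: the improper integral `∫_d^∞` converges and its value is `v`. -/
def HasI (s a b c : ℂ) (d : ℝ) (v : ℂ) : Prop :=
  Tendsto (fun T : ℝ => truncI s a b c d T) atTop (𝓝 v)

/-- The domain of the holomorphic continuation of `s ↦ I_s(a,b,c,d)`: all of `ℂ` if `Re a ≠ 0`, and
`ℂ ∖ {0}` if `Re a = 0` (where the sawtooth is constant and contributes a multiple of `d^{-s}/s`). -/
def domain (a : ℂ) : Set ℂ := {s | a.re ≠ 0 ∨ s ≠ 0}

/-- The half-plane on which `I_s(a,b,c,d)` is given by its integral: `Re s > -1` if `Re a ≠ 0`, and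
`Re s > 0` if `Re a = 0`. -/
def halfPlane (a : ℂ) : Set ℂ := {s | (if a.re = 0 then 0 else -1) < s.re}

/-- `F` is a holomorphic continuation of `s ↦ I_s(a,b,c,d)`. -/
def IsContinuation (a b c : ℂ) (d : ℝ) (F : ℂ → ℂ) : Prop :=
  DifferentiableOn ℂ F (domain a) ∧ ∀ s ∈ halfPlane a, HasI s a b c d (F s)

/-- The holomorphic continuation `Ĩ_s(a,b,c,d)` of `I_s(a,b,c,d)` in `s`. -/
def tildeI (s a b c : ℂ) (d : ℝ) : ℂ := Classical.epsilon (IsContinuation a b c d) s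

/-- The parameters that are admitted: `d > 0`, `a ≠ 0`, `d₊ = d` and `d₋ = 1`. -/
def Admissible (a b : ℂ) (d : ℝ) : Prop :=
  0 < d ∧ a ≠ 0 ∧ dPlus a b d = d ∧ dMinus a b d = 1

end AffineMellin

end

/-! Admissibility means exactly what is needed for `ax + b` to stay in the closed upper half-plane
for `x ≥ d`, so that `w = e^{2πi(ax+b)}` satisfies `|w| ≤ 1` there. On that half-plane the branches
of the logarithm fit together and give, off the points where `w = 1`, `logSine = log(1 - w) + i ·
sawtooth` (`logSine_eq`). In the combination of `c = 1/4` and `c = 0` the sawtooth parts cancel, and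
the difference is exactly the continuation of `-∫_d^∞ log(1 - w) x^{-s-1} dx`
(`tildeI_quarter_sub`).

Expanding the logarithm turns this integral into `∑ e^{2πinb}/n · ∫_d^∞ e^{2πinax} x^{-s-1} dx`.
Integration by parts continues each term to an entire function of `s` of size `O(e^{-2πnd Im a}
d^{-Re s} / (n d|a|))`. Together with the coefficient this gives a majorant `1/n²` times `e^{-2π(d
Im a + Im b)}`, so the series is entire and exponentially small (`norm_logMellin_le`). On the
boundary `|w| = 1`, where the power series need not converge absolutely, termwise integration is
justified by Abel summation (`intervalIntegral_log_eq_tsum`).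

The sawtooth depends only on `Re a` and `Re b`. For `Re a ≠ 0` it is a difference of two such
logarithms with real parameters, hence has an entire transform by the same argument; for `Re a = 0`
it is constant and contributes a multiple of `d^{-s}/s`. Uniqueness is the identity theorem. -/

noncomputable section

namespace AffineMellin

open MeasureTheory Set

/-! ### Continuation of the exponential integral by parts. -/

/-- The integrand `e^{lx} x^{-s-1}`. -/
def expPow (l s : ℂ) (x : ℝ) : ℂ := Complex.exp (l * x) * (x : ℂ) ^ (-s - 1)

/-- `k` integrations by parts of `∫_d^∞ e^{lx} x^{-s-1} dx`, which give its continuation to the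
half-plane `Re s > -k`. -/
def expMellin : ℕ → ℂ → ℝ → ℂ → ℂ
  | 0, l, d, s => ∫ x in Ioi d, expPow l s x
  | k + 1, l, d, s => -(expPow l s d / l) + (s + 1) / l * expMellin k l d (s + 1)

/-- The entire continuation in `s` of `∫_d^∞ e^{lx} x^{-s-1} dx`. -/
def expMellinCont (l : ℂ) (d : ℝ) (s : ℂ) : ℂ := expMellin (⌊‖s‖⌋₊ + 2) l d s

theorem hasDerivAt_ofReal_cpow_of_pos {x : ℝ} (hx : 0 < x) (r : ℂ) :
    HasDerivAt (fun y : ℝ => (y : ℂ) ^ r) (r * (x : ℂ) ^ (r - 1)) x := by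
  have h := (hasDerivAt_id (x : ℂ)).cpow_const (c := r) (Or.inl (by simpa using hx))
  simpa using h.comp_ofReal

theorem hasDerivAt_exp_mul_ofReal {l : ℂ} (hl : l ≠ 0) (x : ℝ) :
    HasDerivAt (fun y : ℝ => Complex.exp (l * y) / l) (Complex.exp (l * x)) x := by
  have h : HasDerivAt (fun z : ℂ => Complex.exp (l * z) / l) (Complex.exp (l * x)) (x : ℂ) := by
    have h1 := (((hasDerivAt_id (x : ℂ)).const_mul l).cexp).div_const l
    simpa [mul_div_assoc, hl] using h1
  exact h.comp_ofReal

theorem continuousOn_expPow (l s : ℂ) : ContinuousOn (expPow l s) (Ioi 0) := by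
  intro x hx
  exact ((by fun_prop : Continuous fun x : ℝ => Complex.exp (l * x)).continuousAt.mul
    (hasDerivAt_ofReal_cpow_of_pos hx _).continuousAt).continuousWithinAt

theorem norm_expPow_le {l : ℂ} (hl : l.re ≤ 0) (s : ℂ) {d x : ℝ} (hd : 0 < d) (hx : d ≤ x) :
    ‖expPow l s x‖ ≤ Real.exp (l.re * d) * x ^ (-s.re - 1) := by
  rw [expPow, norm_mul, Complex.norm_cpow_eq_rpow_re_of_pos (hd.trans_le hx), Complex.norm_exp]
  simp only [Complex.mul_re, Complex.ofReal_re, Complex.ofReal_im, mul_zero, sub_zero,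
    Complex.sub_re, Complex.neg_re, Complex.one_re]
  have : 0 < x := hd.trans_le hx
  gcongr ?_ * _
  exact Real.exp_le_exp.2 (mul_le_mul_of_nonpos_left hx hl)

theorem integrableOn_expPow {l : ℂ} (hl : l.re ≤ 0) {s : ℂ} (hs : 0 < s.re) {d : ℝ} (hd : 0 < d) :
    IntegrableOn (expPow l s) (Ioi d) := by
  have h := (integrableOn_Ioi_rpow_of_lt (a := -s.re - 1) (by linarith) hd).const_mul
    (Real.exp (l.re * d))
  refine Integrable.mono' h (((continuousOn_expPow l s).mono ?_).aestronglyMeasurable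
    measurableSet_Ioi) ?_
  · exact fun x hx => hd.trans hx
  · exact (ae_restrict_mem measurableSet_Ioi).mono fun x hx => norm_expPow_le hl s hd (le_of_lt hx)

theorem norm_intervalIntegral_expPow_le {l : ℂ} (hl : l.re ≤ 0) {s : ℂ} (hs : 0 < s.re) {d T : ℝ}
    (hd : 0 < d) (hT : d ≤ T) :
    ‖∫ x in d..T, expPow l s x‖ ≤ Real.exp (l.re * d) * (d ^ (-s.re) / s.re) := by
  have h := (integrableOn_Ioi_rpow_of_lt (a := -s.re - 1) (by linarith) hd).const_mul
    (Real.exp (l.re * d))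
  have h2 := integral_Ioi_rpow_of_lt (a := -s.re - 1) (by linarith) hd
  rw [intervalIntegral.integral_of_le hT]
  calc ‖∫ x in Ioc d T, expPow l s x‖
      ≤ ∫ x in Ioc d T, Real.exp (l.re * d) * x ^ (-s.re - 1) :=
        norm_integral_le_of_norm_le (IntegrableOn.mono_set h Ioc_subset_Ioi_self)
          ((ae_restrict_mem measurableSet_Ioc).mono fun x hx => norm_expPow_le hl s hd hx.1.le)
    _ ≤ ∫ x in Ioi d, Real.exp (l.re * d) * x ^ (-s.re - 1) := by
        refine setIntegral_mono_set h ?_ Ioc_subset_Ioi_self.eventuallyLE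
        refine (ae_restrict_mem measurableSet_Ioi).mono fun x hx => ?_
        have : 0 < x := hd.trans hx
        show 0 ≤ Real.exp (l.re * d) * x ^ (-s.re - 1)
        positivity
    _ = Real.exp (l.re * d) * (d ^ (-s.re) / s.re) := by
        rw [integral_const_mul, h2]
        have : -s.re - 1 + 1 = -s.re := by ring
        rw [this, neg_div_neg_eq]

theorem tendsto_intervalIntegral_expPow {l : ℂ} (hl : l.re ≤ 0) {s : ℂ} (hs : 0 < s.re) {d : ℝ}
    (hd : 0 < d) :
    Tendsto (fun T : ℝ => ∫ x in d..T, expPow l s x) atTop (𝓝 (∫ x in Ioi d, expPow l s x)) :=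
  intervalIntegral_tendsto_integral_Ioi d (integrableOn_expPow hl hs hd) tendsto_id

theorem intervalIntegral_expPow_by_parts {l : ℂ} (hl : l ≠ 0) (s : ℂ) {d T : ℝ}
    (hd : 0 < d) (hT : d ≤ T) :
    ∫ x in d..T, expPow l s x =
      expPow l s T / l - expPow l s d / l + (s + 1) / l * ∫ x in d..T, expPow l (s + 1) x := by
  have hpos : ∀ x ∈ uIcc d T, 0 < x := by
    rw [uIcc_of_le hT]; exact fun x hx => hd.trans_le hx.1
  have hcont (r : ℂ) : ContinuousOn (fun x : ℝ => (x : ℂ) ^ r) (uIcc d T) := fun x hx =>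
    (hasDerivAt_ofReal_cpow_of_pos (hpos x hx) r).continuousAt.continuousWithinAt
  have h := intervalIntegral.integral_mul_deriv_eq_deriv_mul (a := d) (b := T)
    (u := fun x : ℝ => (x : ℂ) ^ (-s - 1)) (u' := fun x : ℝ => (-s - 1) * (x : ℂ) ^ (-s - 1 - 1))
    (v := fun x : ℝ => Complex.exp (l * x) / l) (v' := fun x : ℝ => Complex.exp (l * x))
    (fun x hx => hasDerivAt_ofReal_cpow_of_pos (hpos x hx) _)
    (fun x _ => hasDerivAt_exp_mul_ofReal hl x)
    ((continuousOn_const.mul (hcont _)).intervalIntegrable)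
    ((by fun_prop : Continuous fun x : ℝ => Complex.exp (l * x)).intervalIntegrable _ _)
  have e1 : ∫ x in d..T, expPow l s x = ∫ x in d..T, (x : ℂ) ^ (-s - 1) * Complex.exp (l * x) := by
    simp only [expPow, mul_comm]
  have e2 : ∫ x in d..T, (-s - 1) * (x : ℂ) ^ (-s - 1 - 1) * (Complex.exp (l * x) / l)
      = (-s - 1) / l * ∫ x in d..T, expPow l (s + 1) x := by
    rw [← intervalIntegral.integral_const_mul]
    refine intervalIntegral.integral_congr fun x _ => ?_
    simp only [expPow]
    rw [show -(s + 1) - 1 = -s - 1 - 1 by ring]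
    ring
  rw [e1, h, e2]
  simp only [expPow]
  ring

/-- Disposes of the boundary term at infinity; `Re s > -1` makes the power alone decay, even for
purely oscillating exponentials. -/
theorem tendsto_expPow_atTop {l : ℂ} (hl : l.re ≤ 0) {s : ℂ} (hs : -1 < s.re) :
    Tendsto (expPow l s) atTop (𝓝 0) := by
  have h : Tendsto (fun x : ℝ => Real.exp (l.re * 1) * x ^ (-(s.re + 1))) atTop (𝓝 0) := by
    simpa using (tendsto_rpow_neg_atTop (by linarith : 0 < s.re + 1)).const_mul (Real.exp (l.re * 1))
  refine squeeze_zero_norm' ?_ h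
  filter_upwards [eventually_ge_atTop 1] with x hx
  rw [neg_add']
  exact norm_expPow_le hl s one_pos hx

/-- The improper integral converges for `Re s > -1`. -/
theorem tendsto_intervalIntegral_expPow_one {l : ℂ} (hl0 : l ≠ 0) (hl : l.re ≤ 0) {s : ℂ}
    (hs : -1 < s.re) {d : ℝ} (hd : 0 < d) :
    Tendsto (fun T : ℝ => ∫ x in d..T, expPow l s x) atTop (𝓝 (expMellin 1 l d s)) := by
  have h1 := tendsto_intervalIntegral_expPow hl (s := s + 1) (by simp; linarith) hd
  have h2 := (((tendsto_expPow_atTop hl hs).div_const l).sub_const (expPow l s d / l)).add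
    (h1.const_mul ((s + 1) / l))
  rw [zero_div, zero_sub] at h2
  refine h2.congr' ?_
  filter_upwards [eventually_ge_atTop d] with T hT
  exact (intervalIntegral_expPow_by_parts hl0 s hd hT).symm

/-- At depth `0` both sides are limits of the same truncated integrals; greater depths follow
because the recursion shifts `s` by `1`. -/
theorem expMellin_succ_eq {l : ℂ} (hl0 : l ≠ 0) (hl : l.re ≤ 0) {d : ℝ} (hd : 0 < d) (k : ℕ) :
    ∀ s : ℂ, -(k : ℝ) < s.re → expMellin (k + 1) l d s = expMellin k l d s := by
  induction k with
  | zero =>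
    intro s hs
    have hs : 0 < s.re := by simpa using hs
    exact tendsto_nhds_unique (tendsto_intervalIntegral_expPow_one hl0 hl (by linarith) hd)
      (tendsto_intervalIntegral_expPow hl hs hd)
  | succ k ih =>
    intro s hs
    rw [expMellin, ih, expMellin]
    push_cast at hs
    simp only [Complex.add_re, Complex.one_re]
    linarith

theorem expMellin_eq_of_le {l : ℂ} (hl0 : l ≠ 0) (hl : l.re ≤ 0) {d : ℝ} (hd : 0 < d) {k m : ℕ}
    (hkm : k ≤ m) {s : ℂ} (hs : -(k : ℝ) < s.re) : expMellin m l d s = expMellin k l d s := by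
  induction m, hkm using Nat.le_induction with
  | base => rfl
  | succ m hm ih =>
    rw [expMellin_succ_eq hl0 hl hd m s, ih]
    have : (k : ℝ) ≤ m := by exact_mod_cast hm
    linarith

/-- The depth in `expMellinCont` varies with `s`, which hides holomorphy. Any sufficient fixed depth
gives the same value, so near each point the depth may be held constant. -/
theorem expMellinCont_eq {l : ℂ} (hl0 : l ≠ 0) (hl : l.re ≤ 0) {d : ℝ} (hd : 0 < d) {k : ℕ}
    {s : ℂ} (hs : -(k : ℝ) < s.re) : expMellinCont l d s = expMellin k l d s := by
  rw [expMellinCont]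
  have h : -((⌊‖s‖⌋₊ + 2 : ℕ) : ℝ) < s.re := by
    have h1 := Nat.lt_floor_add_one ‖s‖
    have h2 := (abs_le.1 (Complex.abs_re_le_norm s)).1
    push_cast
    linarith
  rcases le_total k (⌊‖s‖⌋₊ + 2) with hk | hk
  · exact expMellin_eq_of_le hl0 hl hd hk hs
  · exact (expMellin_eq_of_le hl0 hl hd hk h).symm

/-- Gives depth `0` the holomorphy of Mellin transforms, at the reflected argument `-s`. -/
theorem expMellin_zero_eq_mellin (l : ℂ) {d : ℝ} (hd : 0 < d) (s : ℂ) :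
    expMellin 0 l d s = mellin ((Ioi d).indicator fun x : ℝ => Complex.exp (l * x)) (-s) := by
  rw [expMellin, mellin]
  simp only [smul_eq_mul]
  have : ∀ x : ℝ, (x : ℂ) ^ (-s - 1) * (Ioi d).indicator (fun x : ℝ => Complex.exp (l * x)) x
      = (Ioi d).indicator (expPow l s) x := by
    intro x
    by_cases hx : x ∈ Ioi d <;> simp [hx, expPow, mul_comm]
  simp only [this]
  rw [setIntegral_indicator measurableSet_Ioi, inter_eq_right.2 (Ioi_subset_Ioi hd.le)]

theorem differentiableAt_expMellin {l : ℂ} (hl : l.re ≤ 0) {d : ℝ} (hd : 0 < d) (k : ℕ) :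
    ∀ s : ℂ, -(k : ℝ) < s.re → DifferentiableAt ℂ (expMellin k l d) s := by
  induction k with
  | zero =>
    intro s hs
    have hs : 0 < s.re := by simpa using hs
    have hm : DifferentiableAt ℂ
        (mellin ((Ioi d).indicator fun x : ℝ => Complex.exp (l * x))) (-s) := by
      -- The truncated exponential is bounded at infinity (exponent `0`) and vanishes near `0`, so
      -- any exponent below `-Re s` serves there.
      refine mellin_differentiableAt_of_isBigO_rpow (a := 0) (b := -s.re - 1) ?_ ?_ (by simpa) ?_
        (by simp)
      · refine LocallyIntegrable.locallyIntegrableOn ?_ _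
        exact (by fun_prop : Continuous fun x : ℝ => Complex.exp (l * x)).locallyIntegrable.indicator
          measurableSet_Ioi
      · refine Asymptotics.IsBigO.of_bound 1 ?_
        filter_upwards [eventually_gt_atTop d] with x hx
        have hx' : x ∈ Ioi d := hx
        simp only [hx', indicator_of_mem, Complex.norm_exp, neg_zero, Real.rpow_zero, norm_one,
          mul_one, Real.exp_le_one_iff, Complex.mul_re, Complex.ofReal_re, Complex.ofReal_im,
          mul_zero, sub_zero]
        exact mul_nonpos_of_nonpos_of_nonneg hl (hd.trans hx).le
      · refine Asymptotics.IsBigO.of_bound 1 ?_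
        filter_upwards [mem_nhdsWithin_of_mem_nhds (Iio_mem_nhds hd)] with x hx
        have hx' : x ∉ Ioi d := fun h => lt_asymm (show d < x from h) hx
        simp only [hx', not_false_eq_true, indicator_of_notMem, norm_zero, one_mul, norm_nonneg]
    have : expMellin 0 l d
        = fun s => mellin ((Ioi d).indicator fun x : ℝ => Complex.exp (l * x)) (-s) :=
      funext fun s => expMellin_zero_eq_mellin l hd s
    rw [this]
    exact hm.comp s differentiableAt_id.neg
  | succ k ih =>
    intro s hs
    push_cast at hs
    have h1 : DifferentiableAt ℂ (fun s => expMellin k l d (s + 1)) s :=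
      (ih (s + 1) (by simp only [Complex.add_re, Complex.one_re]; linarith)).comp s
        (differentiableAt_id.add_const 1)
    have h2 : DifferentiableAt ℂ (fun s => expPow l s d) s := by
      have hd' : (d : ℂ) ≠ 0 := by exact_mod_cast hd.ne'
      unfold expPow
      refine (differentiableAt_const _).mul ?_
      exact ((differentiableAt_id.neg).sub_const 1).const_cpow (Or.inl hd')
    exact (h2.div_const l).neg.add (((differentiableAt_id.add_const 1).div_const l).mul h1)

theorem differentiable_expMellinCont {l : ℂ} (hl0 : l ≠ 0) (hl : l.re ≤ 0) {d : ℝ} (hd : 0 < d) :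
    Differentiable ℂ (expMellinCont l d) := by
  intro s
  obtain ⟨k, hk⟩ := exists_nat_gt (-s.re)
  have hk' : -(k : ℝ) < s.re := by linarith
  refine (differentiableAt_expMellin hl hd k s hk').congr_of_eventuallyEq ?_
  filter_upwards [(isOpen_lt continuous_const Complex.continuous_re).mem_nhds hk'] with z hz
  exact expMellinCont_eq hl0 hl hd hz

/-! ### Uniform bounds for the exponential integral. -/

/-- Each integration by parts gains `1/(|l| d)`, and the weight reproduces itself since `d^{-(s+1)}
= d^{-s}/d`. -/
theorem norm_expMellin_succ_le {k : ℕ} {l s : ℂ} {d M C : ℝ} (hl0 : l ≠ 0) (hl : l.re ≤ 0)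
    (hd : 0 < d) (hM : 0 ≤ M) (hC : ‖s + 1‖ ≤ C)
    (h : ‖expMellin k l d (s + 1)‖ ≤ M * (Real.exp (l.re * d) * d ^ (-(s + 1).re))) :
    ‖expMellin (k + 1) l d s‖ ≤
      (1 + C * M) * (Real.exp (l.re * d) * d ^ (-s.re)) / (‖l‖ * d) := by
  have h2 := norm_expPow_le hl s hd le_rfl
  have hl0' : 0 < ‖l‖ := norm_pos_iff.2 hl0
  have hC0 : 0 ≤ C := (norm_nonneg _).trans hC
  have e1 : d ^ (-s.re - 1) = d ^ (-s.re) / d := Real.rpow_sub_one hd.ne' _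
  have e2 : d ^ (-(s + 1).re) = d ^ (-s.re) / d := by
    rw [← e1]; congr 1; simp only [Complex.add_re, Complex.one_re]; ring
  rw [e1] at h2
  rw [e2] at h
  set X := Real.exp (l.re * d)
  set Y := d ^ (-s.re)
  rw [expMellin]
  calc _ ≤ ‖expPow l s d‖ / ‖l‖ + ‖s + 1‖ / ‖l‖ * ‖expMellin k l d (s + 1)‖ := by
        refine (norm_add_le _ _).trans ?_
        rw [norm_neg, norm_mul, norm_div, norm_div]
    _ ≤ X * (Y / d) / ‖l‖ + C / ‖l‖ * (M * (X * (Y / d))) := by gcongr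
    _ = (1 + C * M) * (X * Y) / (‖l‖ * d) := by field_simp

theorem ne_zero_of_le_norm_mul {δ d : ℝ} {l : ℂ} (hδ : 0 < δ) (h : δ ≤ ‖l‖ * d) : l ≠ 0 := by
  rintro rfl
  simp at h
  linarith

/-- Here the gain `1/(|l| d)` is spent as `1/δ`. The radius `R` is quantified inside the induction
because the recursion moves `s` to `s + 1`. -/
theorem norm_expMellin_le {δ : ℝ} (hδ : 0 < δ) (k : ℕ) : ∀ R : ℝ, 0 ≤ R → ∃ M : ℝ, 0 ≤ M ∧
    ∀ (l : ℂ) (d : ℝ) (s : ℂ), l.re ≤ 0 → 0 < d → δ ≤ ‖l‖ * d → ‖s‖ ≤ R → 1 - (k : ℝ) ≤ s.re →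
      ‖expMellin k l d s‖ ≤ M * (Real.exp (l.re * d) * d ^ (-s.re)) := by
  induction k with
  | zero =>
    intro R _
    refine ⟨1, zero_le_one, fun l d s hl hd _ _ hs => ?_⟩
    have hs : 1 ≤ s.re := by simpa using hs
    have h := le_of_tendsto (tendsto_intervalIntegral_expPow hl (s := s) (by linarith) hd).norm
      ((eventually_ge_atTop d).mono fun T hT =>
        norm_intervalIntegral_expPow_le hl (by linarith) hd hT)
    refine h.trans ?_
    rw [one_mul]
    gcongr
    exact div_le_self (by positivity) hs
  | succ k ih =>
    intro R hR
    obtain ⟨M, hM, h⟩ := ih (R + 1) (by positivity)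
    refine ⟨1 / δ + (R + 1) / δ * M, by positivity, fun l d s hl hd hld hsR hs => ?_⟩
    push_cast at hs
    have hs1 : ‖s + 1‖ ≤ R + 1 := (norm_add_le _ _).trans (by simpa using hsR)
    have h1 := h l d (s + 1) hl hd hld hs1 (by simp only [Complex.add_re, Complex.one_re]; linarith)
    have h2 := norm_expPow_le hl s hd le_rfl
    refine (norm_expMellin_succ_le (ne_zero_of_le_norm_mul hδ hld) hl hd hM hs1 h1).trans ?_
    calc _ ≤ (1 + (R + 1) * M) * (Real.exp (l.re * d) * d ^ (-s.re)) / δ := by gcongr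
      _ = (1 / δ + (R + 1) / δ * M) * (Real.exp (l.re * d) * d ^ (-s.re)) := by field_simp

/-- The continuation is `O(1/|l|)`, uniformly for bounded `s` and `|l| d` bounded below. -/
theorem norm_expMellinCont_le {δ R : ℝ} (hδ : 0 < δ) (hR : 0 ≤ R) : ∃ M : ℝ, 0 ≤ M ∧
    ∀ (l : ℂ) (d : ℝ) (s : ℂ), l.re ≤ 0 → 0 < d → δ ≤ ‖l‖ * d → ‖s‖ ≤ R →
      ‖expMellinCont l d s‖ ≤ M * (Real.exp (l.re * d) * d ^ (-s.re)) / (‖l‖ * d) := by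
  obtain ⟨k, hk⟩ := exists_nat_gt (R + 1)
  obtain ⟨M, hM, h⟩ := norm_expMellin_le hδ k (R + 1) (by positivity)
  refine ⟨1 + (R + 1) * M, by positivity, fun l d s hl hd hld hsR => ?_⟩
  have hl0 := ne_zero_of_le_norm_mul hδ hld
  have hre := (abs_le.1 ((Complex.abs_re_le_norm s).trans hsR)).1
  -- One integration by parts beyond depth `k` keeps the factor `1/(|l| d)`.
  rw [expMellinCont_eq hl0 hl hd (k := k + 1) (by push_cast; linarith)]
  have hs1 : ‖s + 1‖ ≤ R + 1 := (norm_add_le _ _).trans (by simpa using hsR)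
  exact norm_expMellin_succ_le hl0 hl hd hM hs1
    (h l d (s + 1) hl hd hld hs1 (by simp only [Complex.add_re, Complex.one_re]; linarith))

/-- The truncated integral is `O(1/|l|)`, uniformly in the truncation, for `Re s > -1`. -/
theorem norm_intervalIntegral_expPow_le_div {l : ℂ} (hl0 : l ≠ 0) (hl : l.re ≤ 0) {s : ℂ}
    (hs : -1 < s.re) {d T : ℝ} (hd : 0 < d) (hT : d ≤ T) :
    ‖∫ x in d..T, expPow l s x‖ ≤
      (2 * d ^ (-s.re - 1) + ‖s + 1‖ * (d ^ (-(s.re + 1)) / (s.re + 1)))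
        * Real.exp (l.re * d) / ‖l‖ := by
  have h1 := norm_intervalIntegral_expPow_le hl (s := s + 1)
    (by simp only [Complex.add_re, Complex.one_re]; linarith) hd hT
  simp only [Complex.add_re, Complex.one_re] at h1
  have h2 := norm_expPow_le hl s hd le_rfl
  have h3 : ‖expPow l s T‖ ≤ Real.exp (l.re * d) * d ^ (-s.re - 1) := by
    refine (norm_expPow_le hl s hd hT).trans ?_
    gcongr ?_ * ?_
    exact Real.rpow_le_rpow_of_nonpos hd hT (by linarith)
  rw [intervalIntegral_expPow_by_parts hl0 s hd hT]
  calc _ ≤ ‖expPow l s T‖ / ‖l‖ + ‖expPow l s d‖ / ‖l‖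
        + ‖s + 1‖ / ‖l‖ * ‖∫ x in d..T, expPow l (s + 1) x‖ := by
        refine (norm_add_le _ _).trans ?_
        rw [norm_mul, norm_div]
        gcongr
        refine (norm_sub_le _ _).trans ?_
        rw [norm_div, norm_div]
    _ ≤ Real.exp (l.re * d) * d ^ (-s.re - 1) / ‖l‖ + Real.exp (l.re * d) * d ^ (-s.re - 1) / ‖l‖
        + ‖s + 1‖ / ‖l‖ * (Real.exp (l.re * d) * (d ^ (-(s.re + 1)) / (s.re + 1))) := by gcongr
    _ = _ := by ring

/-! ### The series of harmonics. -/

/-- The exponential rate `2πi(n+1)a` of the harmonic of index `n + 1`. -/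
def harmonicRate (n : ℕ) (a : ℂ) : ℂ := 2 * Real.pi * Complex.I * (n + 1) * a

/-- The coefficient `e^{2πi(n+1)b} / (n+1)` of the harmonic of index `n + 1`. -/
def harmonicCoeff (n : ℕ) (b : ℂ) : ℂ := Complex.exp (harmonicRate n b) / (n + 1)

/-- The continuation in `s` of `-∫_d^∞ log(1 - e^{2πi(ax+b)}) x^{-s-1} dx`. -/
def logMellin (a b : ℂ) (d : ℝ) (s : ℂ) : ℂ :=
  ∑' n : ℕ, harmonicCoeff n b * expMellinCont (harmonicRate n a) d s

/-- The exponential `e^{2πi(ax+b)}`. -/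
def expLine (a b : ℂ) (x : ℝ) : ℂ := Complex.exp (2 * Real.pi * Complex.I * (a * x + b))

theorem harmonicRate_re (n : ℕ) (a : ℂ) : (harmonicRate n a).re = -(2 * Real.pi * (n + 1) * a.im) := by
  simp [harmonicRate]

theorem norm_harmonicRate (n : ℕ) (a : ℂ) : ‖harmonicRate n a‖ = 2 * Real.pi * (n + 1) * ‖a‖ := by
  have : ‖((n : ℂ) + 1)‖ = n + 1 := by exact_mod_cast Complex.norm_natCast (n + 1)
  simp [harmonicRate, this, abs_of_pos Real.pi_pos]

theorem norm_harmonicCoeff (n : ℕ) (b : ℂ) :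
    ‖harmonicCoeff n b‖ = Real.exp (-(2 * Real.pi * (n + 1) * b.im)) / (n + 1) := by
  have : ‖((n : ℂ) + 1)‖ = n + 1 := by exact_mod_cast Complex.norm_natCast (n + 1)
  rw [harmonicCoeff, norm_div, Complex.norm_exp, harmonicRate_re, this]

theorem harmonicRate_re_nonpos (n : ℕ) {a : ℂ} (ha : 0 ≤ a.im) : (harmonicRate n a).re ≤ 0 := by
  rw [harmonicRate_re, neg_nonpos]
  positivity

theorem harmonicRate_ne_zero (n : ℕ) {a : ℂ} (ha : a ≠ 0) : harmonicRate n a ≠ 0 := by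
  rw [← norm_pos_iff, norm_harmonicRate]
  have := norm_pos_iff.2 ha
  positivity

theorem norm_harmonicCoeff_mul_exp (n : ℕ) (a b : ℂ) (d : ℝ) :
    ‖harmonicCoeff n b‖ * Real.exp ((harmonicRate n a).re * d) =
      Real.exp (-2 * Real.pi * (d * a.im + b.im) * (n + 1)) / (n + 1) := by
  rw [norm_harmonicCoeff, harmonicRate_re, div_mul_eq_mul_div, ← Real.exp_add]
  congr 2
  ring

theorem exp_mul_succ_le {y : ℝ} (hy : 0 ≤ y) (n : ℕ) :
    Real.exp (-2 * Real.pi * y * (n + 1)) ≤ Real.exp (-2 * Real.pi * y) := by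
  apply Real.exp_le_exp.2
  have : 0 ≤ 2 * Real.pi * y * n := by positivity
  linarith

theorem summable_inv_succ_sq : Summable fun n : ℕ => 1 / ((n : ℝ) + 1) ^ 2 := by
  have := (summable_nat_add_iff 1).2 (Real.summable_one_div_nat_pow.2 one_lt_two)
  simpa using this

/-- One factor `1/(n+1)` comes from the Taylor coefficient, the other from `1/|l|`. As `d Im a + Im
b ≥ 0`, every harmonic decays at least as fast as the first. -/
theorem norm_harmonicCoeff_mul_expMellinCont_le {δ R : ℝ} (hδ : 0 < δ) (hR : 0 ≤ R) :
    ∃ M : ℝ, 0 ≤ M ∧ ∀ (n : ℕ) (a b : ℂ) (d : ℝ) (s : ℂ), 0 ≤ a.im → 0 < d → δ ≤ d * ‖a‖ →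
      0 ≤ d * a.im + b.im → ‖s‖ ≤ R →
      ‖harmonicCoeff n b * expMellinCont (harmonicRate n a) d s‖ ≤
        M * d ^ (-s.re) * Real.exp (-2 * Real.pi * (d * a.im + b.im)) * (1 / ((n : ℝ) + 1) ^ 2) := by
  obtain ⟨M, hM, h⟩ := norm_expMellinCont_le (δ := 2 * Real.pi * δ) (by positivity) hR
  refine ⟨M / (2 * Real.pi * δ), by positivity, fun n a b d s ha hd hδa hy hs => ?_⟩
  have hn : (2 * Real.pi * δ) * (n + 1) ≤ ‖harmonicRate n a‖ * d := by
    rw [norm_harmonicRate]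
    calc (2 * Real.pi * δ) * ((n : ℝ) + 1) ≤ (2 * Real.pi * (d * ‖a‖)) * (n + 1) := by gcongr
      _ = _ := by ring
  have hn1 : 2 * Real.pi * δ ≤ ‖harmonicRate n a‖ * d := by
    refine le_trans ?_ hn
    have h1 : (1 : ℝ) ≤ n + 1 := by simp
    exact le_mul_of_one_le_right (by positivity) h1
  rw [norm_mul]
  calc _ ≤ ‖harmonicCoeff n b‖ * (M * (Real.exp ((harmonicRate n a).re * d) * d ^ (-s.re))
          / (‖harmonicRate n a‖ * d)) := by
        gcongr
        exact h _ d s (harmonicRate_re_nonpos n ha) hd hn1 hs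
    _ = (‖harmonicCoeff n b‖ * Real.exp ((harmonicRate n a).re * d)) * (M * d ^ (-s.re))
          / (‖harmonicRate n a‖ * d) := by ring
    _ ≤ (Real.exp (-2 * Real.pi * (d * a.im + b.im)) / (n + 1)) * (M * d ^ (-s.re))
          / ((2 * Real.pi * δ) * (n + 1)) := by
        rw [norm_harmonicCoeff_mul_exp]
        have := exp_mul_succ_le hy n
        gcongr ?_ / _ * _ / ?_
    _ = _ := by field_simp

theorem norm_logMellin_le {δ : ℝ} (hδ : 0 < δ) (s : ℂ) :
    ∃ C : ℝ, ∀ (a b : ℂ) (d : ℝ), 0 ≤ a.im → 0 < d → δ ≤ d * ‖a‖ → 0 ≤ d * a.im + b.im →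
      ‖logMellin a b d s‖ ≤ C * d ^ (-s.re) * Real.exp (-2 * Real.pi * (d * a.im + b.im)) := by
  obtain ⟨M, hM, h⟩ := norm_harmonicCoeff_mul_expMellinCont_le hδ (norm_nonneg s)
  refine ⟨M * ∑' n : ℕ, 1 / ((n : ℝ) + 1) ^ 2, fun a b d ha hd hδa hy => ?_⟩
  refine (tsum_of_norm_bounded (summable_inv_succ_sq.hasSum.mul_left _)
    fun n => h n a b d s ha hd hδa hy le_rfl).trans_eq ?_
  ring

theorem differentiable_logMellin {a b : ℂ} {d : ℝ} (ha0 : a ≠ 0) (ha : 0 ≤ a.im) (hd : 0 < d)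
    (hy : 0 ≤ d * a.im + b.im) : Differentiable ℂ (logMellin a b d) := by
  intro s₀
  have hδ : 0 < d * ‖a‖ := mul_pos hd (norm_pos_iff.2 ha0)
  obtain ⟨M, hM, h⟩ := norm_harmonicCoeff_mul_expMellinCont_le hδ
    (R := ‖s₀‖ + 1) (by positivity)
  -- on the unit ball about `s₀` the power `d ^ (-Re s)` is bounded
  obtain ⟨B, hB⟩ := (isCompact_closedBall s₀ 1).exists_bound_of_continuousOn
    (f := fun s : ℂ => d ^ (-s.re))
    (Continuous.continuousOn (Continuous.rpow continuous_const
      Complex.continuous_re.neg fun _ => Or.inl hd.ne'))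
  have hU : DifferentiableOn ℂ (logMellin a b d) (Metric.ball s₀ 1) := by
    refine Complex.differentiableOn_tsum_of_summable_norm
      (u := fun n : ℕ => M * B * Real.exp (-2 * Real.pi * (d * a.im + b.im))
        * (1 / ((n : ℝ) + 1) ^ 2)) (summable_inv_succ_sq.mul_left _) (fun n => ?_)
      Metric.isOpen_ball fun n s hs => ?_
    · exact ((differentiable_expMellinCont (harmonicRate_ne_zero n ha0)
        (harmonicRate_re_nonpos n ha) hd).const_mul _).differentiableOn
    · have hsR : ‖s‖ ≤ ‖s₀‖ + 1 := by
        have h1 : ‖s - s₀‖ < 1 := by simpa [dist_eq_norm] using hs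
        have h2 := norm_add_le (s - s₀) s₀
        rw [sub_add_cancel] at h2
        linarith
      refine (h n a b d s ha hd le_rfl hy hsR).trans ?_
      gcongr
      exact (le_abs_self _).trans (hB s (Metric.ball_subset_closedBall hs))
  exact (hU s₀ (Metric.mem_ball_self one_pos)).differentiableAt
    (Metric.isOpen_ball.mem_nhds (Metric.mem_ball_self one_pos))

/-! ### Logarithmic singularities of `log(1 - w)`. -/

theorem continuous_expLine (a b : ℂ) : Continuous (expLine a b) := by
  unfold expLine; fun_prop

theorem norm_expLine (a b : ℂ) (x : ℝ) :
    ‖expLine a b x‖ = Real.exp (-2 * Real.pi * (x * a.im + b.im)) := by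
  rw [expLine, Complex.norm_exp]
  congr 1
  simp
  ring

theorem norm_expLine_le {a b : ℂ} {d x : ℝ} (ha : 0 ≤ a.im) (hx : d ≤ x) :
    ‖expLine a b x‖ ≤ Real.exp (-2 * Real.pi * (d * a.im + b.im)) := by
  rw [norm_expLine]
  apply Real.exp_le_exp.2
  have : 2 * Real.pi * (d * a.im) ≤ 2 * Real.pi * (x * a.im) := by gcongr
  linarith

theorem norm_expLine_le_one {a b : ℂ} {d x : ℝ} (ha : 0 ≤ a.im) (hy : 0 ≤ d * a.im + b.im)
    (hx : d ≤ x) : ‖expLine a b x‖ ≤ 1 := by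
  refine (norm_expLine_le ha hx).trans (Real.exp_le_one_iff.2 ?_)
  have : 0 ≤ 2 * Real.pi * (d * a.im + b.im) := by positivity
  linarith

theorem countable_expLine_eq_one {a : ℂ} (ha : a ≠ 0) (b : ℂ) :
    {x : ℝ | expLine a b x = 1}.Countable := by
  refine (countable_range fun n : ℤ => (((n : ℂ) - b) / a).re).mono ?_
  intro x hx
  obtain ⟨n, hn⟩ := Complex.exp_eq_one_iff.1 hx
  refine ⟨n, ?_⟩
  have h2 : (2 * Real.pi * Complex.I : ℂ) ≠ 0 := Complex.two_pi_I_ne_zero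
  have h3 : a * x + b = n := by
    apply mul_left_cancel₀ h2
    rw [hn]; ring
  have h4 : ((n : ℂ) - b) / a = x := by
    rw [← h3]; field_simp; ring
  show (((n : ℂ) - b) / a).re = x
  rw [h4, Complex.ofReal_re]

theorem ae_expLine_ne_one {a : ℂ} (ha : a ≠ 0) (b : ℂ) : ∀ᵐ x : ℝ, expLine a b x ≠ 1 :=
  (countable_expLine_eq_one ha b).ae_notMem volume

/-- `1 - w` is real-analytic in `x`, so its zeros produce only integrable logarithmic singularities.
-/
theorem intervalIntegrable_log_norm_one_sub_expLine (a b : ℂ) (d T : ℝ) :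
    IntervalIntegrable (fun x => Real.log ‖1 - expLine a b x‖) volume d T := by
  refine MeromorphicOn.intervalIntegrable_log_norm fun x _ => AnalyticAt.meromorphicAt ?_
  have h1 : AnalyticAt ℝ (fun x : ℝ => (x : ℂ)) x := Complex.ofRealCLM.analyticAt x
  have h2 : AnalyticAt ℝ (fun x : ℝ => 2 * (Real.pi : ℂ) * Complex.I * (a * x + b)) x :=
    analyticAt_const.mul ((analyticAt_const.mul h1).add analyticAt_const)
  have h3 : AnalyticAt ℝ Complex.exp (2 * (Real.pi : ℂ) * Complex.I * (a * x + b)) :=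
    (Complex.differentiable_exp.analyticAt _).restrictScalars
  exact analyticAt_const.sub (h3.comp_of_eq h2 rfl)

/-- Moving `w` radially inwards brings it no closer to `1` than half its distance: `(1 - r)|w| ≤ 1 -
r|w| ≤ |1 - rw|`. This makes the Abel means dominated uniformly in `r`. -/
theorem norm_one_sub_le_two_mul {w : ℂ} (hw : ‖w‖ ≤ 1) {r : ℝ} (h0 : 0 ≤ r) (h1 : r ≤ 1) :
    ‖1 - w‖ ≤ 2 * ‖1 - r * w‖ := by
  have e1 : ‖1 - w‖ ≤ ‖1 - r * w‖ + (1 - r) * ‖w‖ := by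
    have : 1 - w = (1 - r * w) - ((1 - r : ℝ) : ℂ) * w := by push_cast; ring
    rw [this]
    refine (norm_sub_le _ _).trans_eq ?_
    rw [norm_mul, Complex.norm_real, Real.norm_of_nonneg (by linarith)]
  have e2 : 1 - r * ‖w‖ ≤ ‖1 - r * w‖ := by
    have := norm_sub_norm_le (1 : ℂ) (r * w)
    rwa [norm_one, norm_mul, Complex.norm_real, Real.norm_of_nonneg h0] at this
  have e3 : (1 - r) * ‖w‖ ≤ 1 - r * ‖w‖ := by linarith
  linarith

/-- Abel means of `log(1 - w)` are dominated by its logarithmic singularity. -/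
theorem norm_log_one_sub_le {w : ℂ} (hw : ‖w‖ ≤ 1) (hw1 : w ≠ 1) {r : ℝ} (h0 : 0 ≤ r)
    (h1 : r ≤ 1) :
    ‖Complex.log (1 - r * w)‖ ≤ Real.log 2 + |Real.log ‖1 - w‖| + Real.pi := by
  have hpos : 0 < ‖1 - w‖ := norm_pos_iff.2 (sub_ne_zero.2 hw1.symm)
  have hle := norm_one_sub_le_two_mul hw h0 h1
  have hpos' : 0 < ‖1 - r * w‖ := by linarith
  have hup : ‖1 - r * w‖ ≤ 2 := by
    refine (norm_sub_le _ _).trans ?_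
    rw [norm_one, norm_mul, Complex.norm_real, Real.norm_of_nonneg h0]
    nlinarith [norm_nonneg w]
  refine (Complex.norm_le_abs_re_add_abs_im _).trans ?_
  rw [Complex.log_re, Complex.log_im]
  refine add_le_add (abs_le.2 ⟨?_, ?_⟩) (Complex.abs_arg_le_pi _)
  · have h2 := Real.log_le_log hpos hle
    rw [Real.log_mul two_ne_zero hpos'.ne'] at h2
    have := neg_abs_le (Real.log ‖1 - w‖)
    linarith
  · have h2 := Real.log_le_log hpos' hup
    have := abs_nonneg (Real.log ‖1 - w‖)
    linarith

/-- `Re w ≤ |w| ≤ 1`, with equality throughout only at `w = 1`. -/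
theorem one_sub_mem_slitPlane {w : ℂ} (hw : ‖w‖ ≤ 1) (hw1 : w ≠ 1) : 0 < (1 - w).re := by
  have h1 := (Complex.re_le_norm w).trans hw
  rw [Complex.sub_re, Complex.one_re, sub_pos]
  refine lt_of_le_of_ne h1 fun h => hw1 ?_
  have h2 : w.im = 0 := by
    have h3 : ‖w‖ ^ 2 ≤ 1 := by nlinarith [norm_nonneg w]
    rw [Complex.sq_norm, Complex.normSq_apply, h] at h3
    nlinarith
  exact Complex.ext h h2

theorem measurable_log_one_sub_expLine (a b : ℂ) :
    Measurable fun x => Complex.log (1 - expLine a b x) :=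
  Complex.measurable_log.comp (measurable_const.sub (continuous_expLine a b).measurable)

theorem continuousOn_uIcc_cpow (r : ℂ) {d T : ℝ} (hd : 0 < d) (hT : d ≤ T) :
    ContinuousOn (fun x : ℝ => (x : ℂ) ^ r) (uIcc d T) := by
  rw [uIcc_of_le hT]
  exact fun x hx => (hasDerivAt_ofReal_cpow_of_pos (hd.trans_le hx.1) r).continuousAt.continuousWithinAt

theorem intervalIntegrable_log_bound (a b s : ℂ) {d T : ℝ} (hd : 0 < d) (hT : d ≤ T) :
    IntervalIntegrable (fun x => (Real.log 2 + |Real.log ‖1 - expLine a b x‖| + Real.pi)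
      * ‖(x : ℂ) ^ (-s - 1)‖) volume d T := by
  refine IntervalIntegrable.mul_continuousOn ?_ (continuousOn_uIcc_cpow _ hd hT).norm
  exact (intervalIntegrable_const.add
    (intervalIntegrable_log_norm_one_sub_expLine a b d T).abs).add intervalIntegrable_const

theorem intervalIntegrable_log_one_sub_expLine {a b : ℂ} (ha0 : a ≠ 0) (ha : 0 ≤ a.im) (s : ℂ)
    {d T : ℝ} (hd : 0 < d) (hT : d ≤ T) (hy : 0 ≤ d * a.im + b.im) :
    IntervalIntegrable (fun x : ℝ => -Complex.log (1 - expLine a b x) * (x : ℂ) ^ (-s - 1))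
      volume d T := by
  refine (intervalIntegrable_log_bound a b s hd hT).mono_fun' ?_ ?_
  · refine ((measurable_log_one_sub_expLine a b).neg.aestronglyMeasurable).mul ?_
    exact ((continuousOn_uIcc_cpow _ hd hT).mono uIoc_subset_uIcc).aestronglyMeasurable
      measurableSet_uIoc
  · filter_upwards [ae_restrict_mem measurableSet_uIoc,
      ae_restrict_of_ae (ae_expLine_ne_one ha0 b)] with x hx hx1
    rw [uIoc_of_le hT] at hx
    rw [norm_mul, norm_neg]
    gcongr
    simpa using norm_log_one_sub_le (norm_expLine_le_one ha hy hx.1.le) hx1 zero_le_one le_rfl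

/-! ### Termwise integration and Abel summation. -/

theorem harmonicCoeff_mul_expPow (n : ℕ) (a b s : ℂ) (x : ℝ) :
    harmonicCoeff n b * expPow (harmonicRate n a) s x =
      expLine a b x ^ (n + 1) / ((n : ℂ) + 1) * (x : ℂ) ^ (-s - 1) := by
  have : expLine a b x ^ (n + 1) = Complex.exp (harmonicRate n b) * Complex.exp (harmonicRate n a * x) := by
    rw [expLine, ← Complex.exp_nat_mul, ← Complex.exp_add]
    congr 1
    simp only [harmonicRate]
    push_cast
    ring
  rw [this, harmonicCoeff, expPow]
  ring

theorem hasSum_neg_log_one_sub {w : ℂ} (hw : ‖w‖ < 1) :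
    HasSum (fun n : ℕ => w ^ (n + 1) / ((n : ℂ) + 1)) (-Complex.log (1 - w)) := by
  have := (hasSum_nat_add_iff' 1).2 (Complex.hasSum_taylorSeries_neg_log hw)
  simpa using this

/-- Termwise integration where `|e^{2πi(ax+b)}|` is bounded away from `1`. -/
theorem hasSum_intervalIntegral_log_of_pos {a b : ℂ} (ha : 0 ≤ a.im) (s : ℂ) {d T : ℝ}
    (hd : 0 < d) (hT : d ≤ T) (hy : 0 < d * a.im + b.im) :
    HasSum (fun n : ℕ => harmonicCoeff n b * ∫ x in d..T, expPow (harmonicRate n a) s x)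
      (∫ x in d..T, -Complex.log (1 - expLine a b x) * (x : ℂ) ^ (-s - 1)) := by
  set ρ := Real.exp (-2 * Real.pi * (d * a.im + b.im))
  have hρ0 : 0 ≤ ρ := Real.exp_nonneg _
  have hρ : ρ < 1 := by
    refine Real.exp_lt_one_iff.2 ?_
    have : 0 < 2 * Real.pi * (d * a.im + b.im) := by positivity
    linarith
  have hsum : Summable fun n : ℕ => ρ ^ (n + 1) :=
    (summable_nat_add_iff 1).2 (summable_geometric_of_lt_one hρ0 hρ)
  have hle : ∀ x ∈ uIoc d T, ‖expLine a b x‖ ≤ ρ := fun x hx => by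
    rw [uIoc_of_le hT] at hx
    exact norm_expLine_le ha hx.1.le
  simp only [← intervalIntegral.integral_const_mul]
  refine intervalIntegral.hasSum_integral_of_dominated_convergence
    (fun n x => ρ ^ (n + 1) * ‖(x : ℂ) ^ (-s - 1)‖) (fun n => ?_) (fun n => ?_) ?_ ?_ ?_
  · refine ContinuousOn.aestronglyMeasurable ?_ measurableSet_uIoc
    refine continuousOn_const.mul ((continuousOn_expPow _ _).mono ?_)
    rw [uIoc_of_le hT]
    exact fun x hx => hd.trans hx.1
  · refine Eventually.of_forall fun x hx => ?_
    rw [harmonicCoeff_mul_expPow, norm_mul, norm_div, norm_pow]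
    gcongr
    have hn : ‖((n : ℂ) + 1)‖ = n + 1 := by exact_mod_cast Complex.norm_natCast (n + 1)
    refine (div_le_self (by positivity) (by rw [hn]; simp)).trans ?_
    gcongr
    exact hle x hx
  · exact Eventually.of_forall fun x _ => hsum.mul_right _
  · simp only [tsum_mul_right]
    exact (continuousOn_const.mul (continuousOn_uIcc_cpow _ hd hT).norm).intervalIntegrable
  · refine Eventually.of_forall fun x hx => ?_
    simp only [harmonicCoeff_mul_expPow]
    exact (hasSum_neg_log_one_sub ((hle x hx).trans_lt hρ)).mul_right _

/-- The constant is independent of `b` and `T`, so one majorant serves both the Abel limit in `b`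
and the limit `T → ∞`. -/
theorem norm_harmonicCoeff_mul_integral_le {a : ℂ} (ha0 : a ≠ 0) (ha : 0 ≤ a.im) {s : ℂ}
    (hs : -1 < s.re) {d : ℝ} (hd : 0 < d) : ∃ B : ℝ, ∀ (n : ℕ) (b : ℂ) (T : ℝ),
      d ≤ T → 0 ≤ d * a.im + b.im →
      ‖harmonicCoeff n b * ∫ x in d..T, expPow (harmonicRate n a) s x‖ ≤
        B * (1 / ((n : ℝ) + 1) ^ 2) := by
  set A := 2 * d ^ (-s.re - 1) + ‖s + 1‖ * (d ^ (-(s.re + 1)) / (s.re + 1))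
  have hs' : 0 < s.re + 1 := by linarith
  have hA : 0 ≤ A := by positivity
  have ha' : 0 < ‖a‖ := norm_pos_iff.2 ha0
  refine ⟨A / (2 * Real.pi * ‖a‖), fun n b T hT hy => ?_⟩
  have hexp : Real.exp (-2 * Real.pi * (d * a.im + b.im) * (n + 1)) ≤ 1 := by
    refine Real.exp_le_one_iff.2 ?_
    have : 0 ≤ 2 * Real.pi * (d * a.im + b.im) * (n + 1) := by positivity
    linarith
  rw [norm_mul]
  calc _ ≤ ‖harmonicCoeff n b‖ * (A * Real.exp ((harmonicRate n a).re * d) / ‖harmonicRate n a‖) := by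
        gcongr
        exact norm_intervalIntegral_expPow_le_div (harmonicRate_ne_zero n ha0)
          (harmonicRate_re_nonpos n ha) hs hd hT
    _ = (‖harmonicCoeff n b‖ * Real.exp ((harmonicRate n a).re * d)) * A / ‖harmonicRate n a‖ := by
        ring
    _ ≤ (1 / (n + 1)) * A / (2 * Real.pi * (n + 1) * ‖a‖) := by
        rw [norm_harmonicCoeff_mul_exp, norm_harmonicRate]
        gcongr
    _ = _ := by field_simp

/-- Raising `b` by `iη` multiplies `w` by the Abel radius `e^{-2πη}`. -/
theorem expLine_add_I_mul (a b : ℂ) (η x : ℝ) :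
    expLine a (b + η * Complex.I) x = (Real.exp (-2 * Real.pi * η) : ℂ) * expLine a b x := by
  rw [expLine, expLine, Complex.ofReal_exp, ← Complex.exp_add]
  congr 1
  push_cast
  linear_combination (2 * Real.pi * η) * Complex.I_sq

theorem continuous_harmonicCoeff (n : ℕ) : Continuous (harmonicCoeff n) := by
  unfold harmonicCoeff harmonicRate
  fun_prop

/-- Termwise integration up to the boundary `|e^{2πi(ax+b)}| = 1`, by Abel summation. -/
theorem intervalIntegral_log_eq_tsum {a b : ℂ} (ha0 : a ≠ 0) (ha : 0 ≤ a.im) {s : ℂ}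
    (hs : -1 < s.re) {d T : ℝ} (hd : 0 < d) (hT : d ≤ T) (hy : 0 ≤ d * a.im + b.im) :
    ∫ x in d..T, -Complex.log (1 - expLine a b x) * (x : ℂ) ^ (-s - 1) =
      ∑' n : ℕ, harmonicCoeff n b * ∫ x in d..T, expPow (harmonicRate n a) s x := by
  have hpos : ∀ᶠ η : ℝ in 𝓝[>] 0, 0 < η := self_mem_nhdsWithin
  have him (η : ℝ) : d * a.im + (b + η * Complex.I).im = d * a.im + b.im + η := by
    simp; ring
  have hr (η : ℝ) (hη : 0 < η) : Real.exp (-2 * Real.pi * η) ≤ 1 := by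
    refine Real.exp_le_one_iff.2 ?_
    have : 0 ≤ 2 * Real.pi * η := by positivity
    linarith
  have hint : Tendsto (fun η : ℝ => ∫ x in d..T,
      -Complex.log (1 - expLine a (b + η * Complex.I) x) * (x : ℂ) ^ (-s - 1)) (𝓝[>] 0)
      (𝓝 (∫ x in d..T, -Complex.log (1 - expLine a b x) * (x : ℂ) ^ (-s - 1))) := by
    refine intervalIntegral.tendsto_integral_filter_of_dominated_convergence
      (fun x => (Real.log 2 + |Real.log ‖1 - expLine a b x‖| + Real.pi) * ‖(x : ℂ) ^ (-s - 1)‖)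
      ?_ ?_ (intervalIntegrable_log_bound a b s hd hT) ?_
    · refine Eventually.of_forall fun η => ?_
      refine ((measurable_log_one_sub_expLine _ _).neg.aestronglyMeasurable).mul ?_
      exact ((continuousOn_uIcc_cpow _ hd hT).mono uIoc_subset_uIcc).aestronglyMeasurable
        measurableSet_uIoc
    · filter_upwards [hpos] with η hη
      filter_upwards [ae_expLine_ne_one ha0 b] with x hx1 hx
      rw [uIoc_of_le hT] at hx
      rw [norm_mul, norm_neg, expLine_add_I_mul]
      gcongr
      exact norm_log_one_sub_le (norm_expLine_le_one ha hy hx.1.le) hx1 (Real.exp_nonneg _) (hr η hη)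
    · filter_upwards [ae_expLine_ne_one ha0 b] with x hx1 hx
      rw [uIoc_of_le hT] at hx
      refine Tendsto.mul_const _ (Tendsto.neg ?_)
      have hslit : 1 - expLine a b x ∈ Complex.slitPlane :=
        Or.inl (one_sub_mem_slitPlane (norm_expLine_le_one ha hy hx.1.le) hx1)
      refine ((continuousAt_clog hslit).tendsto.comp ?_)
      have hc : Continuous fun η : ℝ => 1 - expLine a (b + η * Complex.I) x := by
        unfold expLine; fun_prop
      have := hc.tendsto 0
      simp only [Complex.ofReal_zero, zero_mul, add_zero] at this
      exact this.mono_left nhdsWithin_le_nhds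
  obtain ⟨B, hB⟩ := norm_harmonicCoeff_mul_integral_le ha0 ha hs hd
  have htsum : Tendsto (fun η : ℝ => ∑' n : ℕ, harmonicCoeff n (b + η * Complex.I)
      * ∫ x in d..T, expPow (harmonicRate n a) s x) (𝓝[>] 0)
      (𝓝 (∑' n : ℕ, harmonicCoeff n b * ∫ x in d..T, expPow (harmonicRate n a) s x)) := by
    refine tendsto_tsum_of_dominated_convergence (summable_inv_succ_sq.mul_left B) (fun n => ?_) ?_
    · have hc : Continuous fun η : ℝ => harmonicCoeff n (b + η * Complex.I) :=
        (continuous_harmonicCoeff n).comp (by fun_prop)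
      have := hc.tendsto 0
      simp only [Complex.ofReal_zero, zero_mul, add_zero] at this
      exact (this.mono_left nhdsWithin_le_nhds).mul_const _
    · filter_upwards [hpos] with η hη n
      exact hB n _ T hT (by rw [him]; linarith)
  -- For `η > 0` the path lies strictly inside the unit disc and the two sides agree; their limits
  -- as `η → 0` therefore agree.
  refine tendsto_nhds_unique hint (htsum.congr' ?_)
  filter_upwards [hpos] with η hη
  exact (hasSum_intervalIntegral_log_of_pos ha s hd hT (by rw [him]; linarith)).tsum_eq

theorem tendsto_intervalIntegral_log {a b : ℂ} (ha0 : a ≠ 0) (ha : 0 ≤ a.im) {s : ℂ}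
    (hs : -1 < s.re) {d : ℝ} (hd : 0 < d) (hy : 0 ≤ d * a.im + b.im) :
    Tendsto (fun T : ℝ => ∫ x in d..T, -Complex.log (1 - expLine a b x) * (x : ℂ) ^ (-s - 1)) atTop
      (𝓝 (logMellin a b d s)) := by
  obtain ⟨B, hB⟩ := norm_harmonicCoeff_mul_integral_le ha0 ha hs hd
  have h : Tendsto (fun T : ℝ => ∑' n : ℕ, harmonicCoeff n b
      * ∫ x in d..T, expPow (harmonicRate n a) s x) atTop (𝓝 (logMellin a b d s)) := by
    refine tendsto_tsum_of_dominated_convergence (summable_inv_succ_sq.mul_left B) (fun n => ?_) ?_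
    · have hl := harmonicRate_ne_zero n ha0
      have hl' := harmonicRate_re_nonpos n ha
      rw [expMellinCont_eq hl hl' hd (k := 1) (by push_cast; exact hs)]
      exact (tendsto_intervalIntegral_expPow_one hl hl' hs hd).const_mul _
    · filter_upwards [eventually_ge_atTop d] with T hT n
      exact hB n b T hT hy
  refine h.congr' ?_
  filter_upwards [eventually_ge_atTop d] with T hT
  exact (intervalIntegral_log_eq_tsum ha0 ha hs hd hT hy).symm

/-! ### Admissibility, and the branches of the logarithms. -/

/-- `d₊ = d` places no zero of `x Im a + Im b` beyond `d`, and `d₋ = 1` makes its value at `2d` the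
sign test. If `Im a < 0`, the first forces a value `≤ 0` at `d`, hence a negative one in the second.
-/
theorem Admissible.im_nonneg {a b : ℂ} {d : ℝ} (h : Admissible a b d) :
    0 ≤ a.im ∧ 0 ≤ d * a.im + b.im := by
  obtain ⟨hd, -, hp, hm⟩ := h
  have hnc : ¬(a.im ≠ 0 ∧ d < -b.im / a.im) := by
    intro hc
    rw [dPlus, if_pos hc] at hp
    exact absurd hc.2 (by rw [hp]; exact lt_irrefl d)
  rw [dMinus, hp] at hm
  by_cases h0 : a.im = 0 ∧ b.im = 0
  · simp [h0.1, h0.2]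
  rw [if_neg h0, sgn] at hm
  have hs : 0 ≤ 2 * d * a.im + b.im := by
    by_contra hcon
    rw [if_neg hcon] at hm
    norm_num at hm
  rcases lt_trichotomy a.im 0 with ha | ha | ha
  · have h1 : -b.im / a.im ≤ d := not_lt.1 fun h => hnc ⟨ha.ne, h⟩
    rw [div_le_iff_of_neg ha] at h1
    nlinarith
  · rw [ha] at hs ⊢
    exact ⟨le_rfl, by linarith⟩
  · have h1 : -b.im / a.im ≤ d := not_lt.1 fun h => hnc ⟨ha.ne', h⟩
    rw [div_le_iff₀ ha] at h1
    exact ⟨ha.le, by linarith⟩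

/-- `-e^{-2πiz}`, whose logarithm defines `frac`. -/
def fracExp (z : ℂ) : ℂ := Complex.exp (-Complex.I * (2 * Real.pi) * (z - 1 / 2))

theorem log_fracExp (z : ℂ) :
    Complex.log (fracExp z) = ((2 * Real.pi * z.im : ℝ) : ℂ) + (fracExp z).arg * Complex.I := by
  have h : (Complex.log (fracExp z)).re = 2 * Real.pi * z.im := by
    rw [Complex.log_re, fracExp, Complex.norm_exp, Real.log_exp]
    simp
  rw [← h, ← Complex.log_im, Complex.re_add_im]

theorem sawtooth_eq_log (a b : ℂ) (x : ℝ) :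
    Complex.I * sawtooth a b x =
      Complex.log (fracExp (a * x + b)) / 2 - ((Real.pi * (a.im * x + b.im) : ℝ) : ℂ) := by
  have hpi : (Real.pi : ℂ) ≠ 0 := by exact_mod_cast Real.pi_ne_zero
  rw [sawtooth, frac, ← fracExp]
  push_cast
  field_simp
  linear_combination (2 * (Real.pi : ℂ) * (a.im * x + b.im)
    - Complex.log (fracExp (a * x + b))) * Complex.I_sq

/-- The correction `i(x Im a + Im b)` cancels exactly the real part of the logarithm, leaving a
real, bounded function. -/
theorem sawtooth_eq_arg (a b : ℂ) (x : ℝ) :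
    sawtooth a b x = (((fracExp (a * x + b)).arg / 2 : ℝ) : ℂ) := by
  apply mul_left_cancel₀ Complex.I_ne_zero
  rw [sawtooth_eq_log, log_fracExp]
  simp
  ring

theorem arg_fracExp (z : ℂ) : (fracExp z).arg = (fracExp z.re).arg := by
  have : fracExp z = (Real.exp (2 * Real.pi * z.im) : ℂ) * fracExp z.re := by
    rw [fracExp, fracExp, Complex.ofReal_exp, ← Complex.exp_add]
    congr 1
    conv_lhs => rw [← Complex.re_add_im z]
    push_cast
    linear_combination (-2 * Real.pi * z.im) * Complex.I_sq
  rw [this, Complex.arg_real_mul _ (Real.exp_pos _)]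

/-- The imaginary part of `ax + b` only rescales `fracExp` by a positive factor, which its argument
does not see. -/
theorem sawtooth_re (a b : ℂ) (x : ℝ) : sawtooth a b x = sawtooth a.re b.re x := by
  rw [sawtooth_eq_arg, sawtooth_eq_arg, arg_fracExp, arg_fracExp (a.re * x + b.re)]
  simp

theorem exp_mul_fracExp (z : ℂ) :
    Complex.exp (2 * Real.pi * Complex.I * z) * fracExp z = -1 := by
  rw [fracExp, ← Complex.exp_add, ← Complex.exp_pi_mul_I]
  congr 1
  ring

theorem four_mul_sin_sq (z : ℂ) :
    4 * Complex.sin (Real.pi * z) ^ 2 =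
      (1 - Complex.exp (2 * Real.pi * Complex.I * z)) ^ 2 * fracExp z := by
  set E := Complex.exp (Real.pi * z * Complex.I) with hE
  have hE0 : E ≠ 0 := Complex.exp_ne_zero _
  have h1 : Complex.exp (2 * Real.pi * Complex.I * z) = E ^ 2 := by
    rw [hE, ← Complex.exp_nat_mul]
    congr 1
    push_cast
    ring
  have h2 : fracExp z = -(E ^ 2)⁻¹ := by
    have := exp_mul_fracExp z
    rw [h1] at this
    field_simp
    linear_combination this
  have h3 : Complex.exp (-(Real.pi * z) * Complex.I) = E⁻¹ := by
    rw [hE, ← Complex.exp_neg]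
    congr 1
    ring
  rw [Complex.sin, h3, ← hE, h2, h1]
  field_simp
  linear_combination 4 * (1 - E ^ 2) ^ 2 * Complex.I_sq

/-- The branch of `log(4 sin²(πz))` on the closed upper half-plane. -/
theorem log_four_mul_sin_sq {z : ℂ} (hw : ‖Complex.exp (2 * Real.pi * Complex.I * z)‖ ≤ 1)
    (hw1 : Complex.exp (2 * Real.pi * Complex.I * z) ≠ 1) :
    Complex.log (4 * Complex.sin (Real.pi * z) ^ 2) =
      2 * Complex.log (1 - Complex.exp (2 * Real.pi * Complex.I * z)) + Complex.log (fracExp z) := by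
  have hmul := exp_mul_fracExp z
  rw [four_mul_sin_sq]
  set w := Complex.exp (2 * Real.pi * Complex.I * z)
  set v := fracExp z with hv
  have hv0 : v ≠ 0 := Complex.exp_ne_zero _
  have hre := one_sub_mem_slitPlane hw hw1
  have hne : 1 - w ≠ 0 := sub_ne_zero.2 hw1.symm
  -- Since `wv = -1`, the imaginary parts of `1 - w` and `v` have opposite signs. As `|2 arg(1 - w)|
  -- < π`, the sum `2 arg(1 - w) + arg v` cannot leave `(-π, π]`, and no multiple of `2πi` appears.
  have hwv : 1 - w = 1 + v⁻¹ := by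
    field_simp
    linear_combination -hmul
  have him : (1 - w).im = -v.im / Complex.normSq v := by
    rw [hwv, Complex.add_im, Complex.one_im, zero_add, Complex.inv_im]
  have hnv : 0 < Complex.normSq v := Complex.normSq_pos.2 hv0
  have harg := abs_lt.1 (Complex.abs_arg_lt_pi_div_two_iff.2 (Or.inl hre))
  have hvarg := Complex.arg_mem_Ioc v
  have hexp : (1 - w) ^ 2 * v = Complex.exp (2 * Complex.log (1 - w) + Complex.log v) := by
    rw [Complex.exp_add, Complex.exp_log hv0, two_mul, Complex.exp_add, Complex.exp_log hne, sq]
  have heq : (2 * Complex.log (1 - w) + Complex.log v).im = 2 * (1 - w).arg + v.arg := by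
    simp [Complex.log_im]
  rw [hexp, Complex.log_exp]
  · rw [heq]
    rcases le_or_gt 0 v.im with h | h
    · have := Complex.arg_nonneg_iff.2 h
      linarith [harg.1]
    · have h1 : 0 ≤ (1 - w).im := by
        rw [him]
        exact div_nonneg (by linarith) hnv.le
      have := Complex.arg_nonneg_iff.2 h1
      linarith [hvarg.1]
  · rw [heq]
    rcases le_or_gt 0 v.im with h | h
    · have h1 : (1 - w).im ≤ 0 := by
        rw [him]
        exact div_nonpos_of_nonpos_of_nonneg (by linarith) hnv.le
      have h2 : (1 - w).arg ≤ 0 := by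
        rcases h1.lt_or_eq with h1 | h1
        · exact (Complex.arg_neg_iff.2 h1).le
        · exact (Complex.arg_eq_zero_iff.2 ⟨hre.le, h1⟩).le
      linarith [hvarg.2]
    · have := Complex.arg_neg_iff.2 h
      linarith [harg.2]

theorem logSine_eq {a b : ℂ} {x : ℝ} (hy : 0 ≤ a.im * x + b.im) (hw1 : expLine a b x ≠ 1) :
    logSine a b x = Complex.log (1 - expLine a b x) + Complex.I * sawtooth a b x := by
  have hw : ‖expLine a b x‖ ≤ 1 := by
    rw [norm_expLine, Real.exp_le_one_iff]
    have : 0 ≤ 2 * Real.pi * (a.im * x + b.im) := by positivity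
    linarith
  rw [logSine, sawtooth_eq_log, abs_of_nonneg hy, log_four_mul_sin_sq hw hw1, expLine]
  ring

theorem norm_expLine_ofReal (r β x : ℝ) : ‖expLine r β x‖ ≤ 1 := by
  rw [norm_expLine]
  simp

/-- At real points `4 sin²(πu) ≥ 0` has argument `0`; this is the imaginary part of the branch
identity. -/
theorem arg_fracExp_ofReal {u : ℝ} (hw1 : Complex.exp (2 * Real.pi * Complex.I * u) ≠ 1) :
    (fracExp u).arg = -2 * (1 - Complex.exp (2 * Real.pi * Complex.I * u)).arg := by
  have hw : ‖Complex.exp (2 * Real.pi * Complex.I * u)‖ ≤ 1 := by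
    rw [Complex.norm_exp]
    simp
  have h := congrArg Complex.im (log_four_mul_sin_sq hw hw1)
  have h4 : 4 * Complex.sin (Real.pi * u) ^ 2 = ((4 * Real.sin (Real.pi * u) ^ 2 : ℝ) : ℂ) := by
    push_cast; rfl
  rw [h4, Complex.log_im, Complex.arg_ofReal_of_nonneg (by positivity), Complex.add_im,
    Complex.log_im] at h
  have h5 : (2 * Complex.log (1 - Complex.exp (2 * Real.pi * Complex.I * u))).im
      = 2 * (1 - Complex.exp (2 * Real.pi * Complex.I * u)).arg := by
    simp [Complex.log_im]
  linarith

theorem expLine_neg_ofReal (r β x : ℝ) :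
    expLine (-r : ℝ) (-β : ℝ) x = (starRingEnd ℂ) (expLine r β x) := by
  have h2 : (starRingEnd ℂ) 2 = 2 := map_ofNat _ 2
  rw [expLine, expLine, ← Complex.exp_conj]
  congr 1
  simp [h2]
  ring

/-- The Fourier series of the sawtooth in closed form: negating real parameters conjugates the
logarithm, and the difference isolates its imaginary part. Real parameters meet the sign conditions
of the logarithmic integrals trivially. -/
theorem sawtooth_eq_log_sub_log {a b : ℂ} {x : ℝ} (hw1 : expLine a.re b.re x ≠ 1) :
    sawtooth a b x = 1 / (2 * Complex.I) * (-Complex.log (1 - expLine a.re b.re x)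
      - -Complex.log (1 - expLine (-a.re : ℝ) (-b.re : ℝ) x)) := by
  have hre := one_sub_mem_slitPlane (norm_expLine_ofReal a.re b.re x) hw1
  have hconj : Complex.log (1 - expLine (-a.re : ℝ) (-b.re : ℝ) x)
      = (starRingEnd ℂ) (Complex.log (1 - expLine a.re b.re x)) := by
    rw [expLine_neg_ofReal, ← Complex.log_conj, map_sub, map_one]
    have := abs_lt.1 (Complex.abs_arg_lt_pi_div_two_iff.2 (Or.inl hre))
    linarith [Real.pi_pos]
  have harg := arg_fracExp_ofReal (u := a.re * x + b.re) (by simpa [expLine] using hw1)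
  have hw : Complex.exp (2 * Real.pi * Complex.I * ((a.re * x + b.re : ℝ) : ℂ))
      = expLine a.re b.re x := by
    rw [expLine]; push_cast; rfl
  rw [hw] at harg
  rw [sawtooth_re, sawtooth_eq_arg, hconj]
  have hu : (a.re : ℂ) * x + b.re = ((a.re * x + b.re : ℝ) : ℂ) := by push_cast; rfl
  rw [hu, harg]
  have hsub := Complex.sub_conj (Complex.log (1 - expLine a.re b.re x))
  rw [Complex.log_im] at hsub
  have hI := Complex.I_ne_zero
  push_cast at hsub ⊢
  field_simp
  linear_combination hsub

/-! ### Continuation of the two transforms. -/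

theorem intervalIntegrable_sawtooth (a b s : ℂ) {d T : ℝ} (hd : 0 < d) (hT : d ≤ T) :
    IntervalIntegrable (fun x : ℝ => sawtooth a b x * (x : ℂ) ^ (-s - 1)) volume d T := by
  refine IntervalIntegrable.mul_continuousOn ?_ (continuousOn_uIcc_cpow _ hd hT)
  have hm : Measurable (sawtooth a b) := by
    have : sawtooth a b = fun x : ℝ => (((fracExp (a * x + b)).arg / 2 : ℝ) : ℂ) :=
      funext fun x => sawtooth_eq_arg a b x
    rw [this]
    have hc : Continuous fun x : ℝ => fracExp (a * x + b) := by unfold fracExp; fun_prop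
    exact Complex.measurable_ofReal.comp
      ((Complex.measurable_arg.comp hc.measurable).div_const 2)
  refine (intervalIntegrable_const (c := Real.pi / 2)).mono_fun' hm.aestronglyMeasurable
    (Eventually.of_forall fun x => ?_)
  show ‖sawtooth a b x‖ ≤ Real.pi / 2
  rw [sawtooth_eq_arg, Complex.norm_real, Real.norm_eq_abs, abs_div, abs_two]
  gcongr
  exact Complex.abs_arg_le_pi _

/-- The continuation in `s` of the sawtooth integral. -/
def sawMellin (a b : ℂ) (d : ℝ) (s : ℂ) : ℂ :=
  if a.re = 0 then sawtooth a b d * ((d : ℂ) ^ (-s) / s)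
  else 1 / (2 * Complex.I) * (logMellin a.re b.re d s - logMellin (-a.re : ℝ) (-b.re : ℝ) d s)

theorem differentiableOn_sawMellin (a b : ℂ) {d : ℝ} (hd : 0 < d) :
    DifferentiableOn ℂ (sawMellin a b d) (domain a) := by
  intro s hs
  refine DifferentiableAt.differentiableWithinAt ?_
  by_cases h : a.re = 0
  · have hs0 : s ≠ 0 := hs.resolve_left (not_not.2 h)
    have hd' : (d : ℂ) ≠ 0 := by exact_mod_cast hd.ne'
    have : sawMellin a b d = fun s => sawtooth a b d * ((d : ℂ) ^ (-s) / s) :=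
      funext fun s => if_pos h
    rw [this]
    exact (((differentiableAt_id.neg).const_cpow (Or.inl hd')).div differentiableAt_id hs0).const_mul _
  · have : sawMellin a b d = fun s => 1 / (2 * Complex.I) *
        (logMellin a.re b.re d s - logMellin (-a.re : ℝ) (-b.re : ℝ) d s) :=
      funext fun s => if_neg h
    rw [this]
    have h1 : Differentiable ℂ (logMellin a.re b.re d) :=
      differentiable_logMellin (by exact_mod_cast h) (by simp) hd (by simp)
    have h2 : Differentiable ℂ (logMellin (-a.re : ℝ) (-b.re : ℝ) d) :=
      differentiable_logMellin (by exact_mod_cast neg_ne_zero.2 h) (by simp) hd (by simp)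
    exact ((h1 s).sub (h2 s)).const_mul _

theorem tendsto_intervalIntegral_sawtooth (a b : ℂ) {d : ℝ} (hd : 0 < d) {s : ℂ}
    (hs : s ∈ halfPlane a) :
    Tendsto (fun T : ℝ => ∫ x in d..T, sawtooth a b x * (x : ℂ) ^ (-s - 1)) atTop
      (𝓝 (sawMellin a b d s)) := by
  by_cases h : a.re = 0
  · have hs' : 0 < s.re := by simpa [halfPlane, h] using hs
    have hre : (-s - 1).re < -1 := by simp; linarith
    have hlim := (intervalIntegral_tendsto_integral_Ioi d (integrableOn_Ioi_cpow_of_lt hre hd)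
      tendsto_id).const_mul (sawtooth a b d)
    rw [integral_Ioi_cpow_of_lt hre hd, sub_add_cancel, neg_div_neg_eq] at hlim
    rw [sawMellin, if_pos h]
    refine hlim.congr fun T => ?_
    rw [← intervalIntegral.integral_const_mul]
    refine intervalIntegral.integral_congr fun x _ => ?_
    -- With `Re a = 0` the sawtooth does not depend on `x`.
    rw [sawtooth_re a b x, sawtooth_re a b d, h]
    simp [sawtooth]
  · have hs' : -1 < s.re := by simpa [halfPlane, h] using hs
    have h1 : (a.re : ℂ) ≠ 0 := by exact_mod_cast h
    have h2 : ((-a.re : ℝ) : ℂ) ≠ 0 := by exact_mod_cast neg_ne_zero.2 h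
    have hlim := ((tendsto_intervalIntegral_log (b := b.re) h1 (by simp) hs' hd (by simp)).sub
      (tendsto_intervalIntegral_log (b := (-b.re : ℝ)) h2 (by simp) hs' hd (by simp))).const_mul
      (1 / (2 * Complex.I))
    rw [sawMellin, if_neg h]
    refine hlim.congr' ?_
    filter_upwards [eventually_ge_atTop d] with T hT
    rw [← intervalIntegral.integral_sub
      (intervalIntegrable_log_one_sub_expLine h1 (by simp) s hd hT (by simp))
      (intervalIntegrable_log_one_sub_expLine h2 (by simp) s hd hT (by simp)),
      ← intervalIntegral.integral_const_mul]
    refine intervalIntegral.integral_congr_ae ?_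
    filter_upwards [ae_expLine_ne_one h1 b.re] with x hx _
    rw [sawtooth_eq_log_sub_log hx]
    ring

theorem neg_one_lt_re_of_mem_halfPlane {a s : ℂ} (hs : s ∈ halfPlane a) : -1 < s.re := by
  have hs : (if a.re = 0 then (0 : ℝ) else -1) < s.re := hs
  split_ifs at hs <;> linarith

theorem tendsto_intervalIntegral_logSine {a b : ℂ} {d : ℝ} (h : Admissible a b d) {s : ℂ}
    (hs : s ∈ halfPlane a) :
    Tendsto (fun T : ℝ => ∫ x in d..T, logSine a b x * (x : ℂ) ^ (-s - 1)) atTop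
      (𝓝 (-logMellin a b d s + Complex.I * sawMellin a b d s)) := by
  obtain ⟨ha, hy⟩ := h.im_nonneg
  have hlim := (tendsto_intervalIntegral_log h.2.1 ha (neg_one_lt_re_of_mem_halfPlane hs) h.1 hy).neg.add
    ((tendsto_intervalIntegral_sawtooth a b h.1 hs).const_mul Complex.I)
  refine hlim.congr' ?_
  filter_upwards [eventually_ge_atTop d] with T hT
  have hneg : IntervalIntegrable
      (fun x : ℝ => -(-Complex.log (1 - expLine a b x) * (x : ℂ) ^ (-s - 1))) volume d T :=
    (intervalIntegrable_log_one_sub_expLine h.2.1 ha s h.1 hT hy).neg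
  rw [← intervalIntegral.integral_neg, ← intervalIntegral.integral_const_mul,
    ← intervalIntegral.integral_add hneg
      ((intervalIntegrable_sawtooth a b s h.1 hT).const_mul _)]
  refine intervalIntegral.integral_congr_ae ?_
  filter_upwards [ae_expLine_ne_one h.2.1 b] with x hx hxI
  rw [uIoc_of_le hT] at hxI
  have hyx : 0 ≤ a.im * x + b.im := by
    have := mul_le_mul_of_nonneg_left hxI.1.le ha
    linarith
  rw [logSine_eq hyx hx]
  ring

/-! ### Uniqueness, the exact difference, and its decay. -/

/-- The holomorphic continuation of `s ↦ I_s(a,b,c,d)` for admissible parameters. -/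
def continuedI (a b c : ℂ) (d : ℝ) (s : ℂ) : ℂ :=
  Complex.cos (2 * Real.pi * c) * sawMellin a b d s
    - Complex.sin (2 * Real.pi * c) * (-logMellin a b d s + Complex.I * sawMellin a b d s)

theorem isContinuation_continuedI {a b : ℂ} {d : ℝ} (h : Admissible a b d) (c : ℂ) :
    IsContinuation a b c d (continuedI a b c d) := by
  obtain ⟨ha, hy⟩ := h.im_nonneg
  refine ⟨?_, fun s hs => ?_⟩
  · have h1 := differentiableOn_sawMellin a b h.1
    have h2 := (differentiable_logMellin h.2.1 ha h.1 hy).differentiableOn (s := domain a)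
    exact (h1.const_mul _).sub ((h2.neg.add (h1.const_mul _)).const_mul _)
  · exact ((tendsto_intervalIntegral_sawtooth a b h.1 hs).const_mul _).sub
      ((tendsto_intervalIntegral_logSine h hs).const_mul _)

theorem domain_isOpen_and_isPreconnected (a : ℂ) : IsOpen (domain a) ∧ IsPreconnected (domain a) := by
  by_cases h : a.re = 0
  · have : domain a = {0}ᶜ := by ext s; simp [domain, h]
    rw [this]
    exact ⟨isOpen_compl_singleton,
      (isConnected_compl_singleton_of_one_lt_rank (by simp) 0).isPreconnected⟩
  · have : domain a = univ := by ext s; simp [domain, h]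
    rw [this]
    exact ⟨isOpen_univ, isPreconnected_univ⟩

/-- Identity theorem on a connected open set, started at `s = 1`, which lies in the half-plane of
convergence in both cases. -/
theorem IsContinuation.eqOn {a b c : ℂ} {d : ℝ} {F G : ℂ → ℂ} (hF : IsContinuation a b c d F)
    (hG : IsContinuation a b c d G) : EqOn F G (domain a) := by
  obtain ⟨ho, hc⟩ := domain_isOpen_and_isPreconnected a
  refine (hF.1.analyticOnNhd ho).eqOn_of_preconnected_of_eventuallyEq (hG.1.analyticOnNhd ho) hc
    (z₀ := 1) (Or.inr one_ne_zero) ?_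
  have h1 : (1 : ℂ) ∈ halfPlane a := by
    show (if a.re = 0 then (0 : ℝ) else -1) < (1 : ℂ).re
    split_ifs <;> norm_num
  filter_upwards [(isOpen_lt continuous_const Complex.continuous_re).mem_nhds h1] with s hs
  exact tendsto_nhds_unique (hF.2 s hs) (hG.2 s hs)

/-- `tildeI` is an arbitrary choice of continuation, so only its values on `domain a` are
determined. -/
theorem tildeI_eq {a b : ℂ} {d : ℝ} (h : Admissible a b d) (c : ℂ) {s : ℂ} (hs : s ∈ domain a) :
    tildeI s a b c d = continuedI a b c d s :=
  (Classical.epsilon_spec ⟨_, isContinuation_continuedI h c⟩ :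
    IsContinuation a b c d _).eqOn (isContinuation_continuedI h c) hs

/-- At `c = 1/4` the cosine vanishes and the sine is `1`; the term `-i · sawMellin` that remains is
the one subtracted. -/
theorem tildeI_quarter_sub {a b : ℂ} {d : ℝ} (h : Admissible a b d) {s : ℂ} (hs : s ∈ domain a) :
    tildeI s a b (1 / 4) d - (-Complex.I * tildeI s a b 0 d) = logMellin a b d s := by
  have hq : 2 * (Real.pi : ℂ) * (1 / 4) = Real.pi / 2 := by ring
  rw [tildeI_eq h _ hs, tildeI_eq h _ hs, continuedI, continuedI, hq, Complex.cos_pi_div_two,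
    Complex.sin_pi_div_two]
  simp

theorem norm_tildeI_quarter_sub_le (s : ℂ) {δ : ℝ} (hδ : 0 < δ) : ∃ C : ℝ, ∀ (a b : ℂ) (d : ℝ),
    Admissible a b d → s ∈ domain a → δ ≤ d * ‖a‖ →
    ‖tildeI s a b (1 / 4) d - (-Complex.I * tildeI s a b 0 d)‖
      ≤ C * d ^ (-s.re) * Real.exp (-2 * Real.pi * (d * a.im + b.im)) := by
  obtain ⟨C, hC⟩ := norm_logMellin_le hδ s
  refine ⟨C, fun a b d h hs hδa => ?_⟩
  rw [tildeI_quarter_sub h hs]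
  exact hC a b d h.im_nonneg.1 h.1 hδa h.im_nonneg.2

theorem tendsto_tildeI_quarter_sub (s : ℂ) {d δ : ℝ} (hd : 0 < d) (hδ : 0 < δ) :
    Tendsto
      (fun p : ℂ × ℂ => tildeI s p.1 p.2 (1 / 4) d - (-Complex.I * tildeI s p.1 p.2 0 d))
      (comap (fun p : ℂ × ℂ => d * p.1.im + p.2.im) atTop ⊓
        𝓟 {p : ℂ × ℂ | Admissible p.1 p.2 d ∧ s ∈ domain p.1 ∧ δ ≤ ‖p.1‖})
      (𝓝 0) := by
  -- For fixed `d`, the condition `|a| ≥ δ` becomes `d|a| ≥ dδ`.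
  obtain ⟨C, hC⟩ := norm_tildeI_quarter_sub_le s (mul_pos hd hδ)
  have hy : Tendsto (fun y : ℝ => C * d ^ (-s.re) * Real.exp (-2 * Real.pi * y)) atTop (𝓝 0) := by
    have h1 : Tendsto (fun y : ℝ => -2 * Real.pi * y) atTop atBot :=
      tendsto_id.const_mul_atTop_of_neg (by linarith [Real.pi_pos])
    simpa using (Real.tendsto_exp_atBot.comp h1).const_mul (C * d ^ (-s.re))
  refine squeeze_zero_norm' ?_ ((hy.comp tendsto_comap).mono_left inf_le_left)
  refine eventually_inf_principal.2 (Eventually.of_forall fun p hp => ?_)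
  exact hC p.1 p.2 d hp.1 hp.2.1 (mul_le_mul_of_nonneg_left hp.2.2 hd.le)

end AffineMellin

end

theorem corollary2p3 :
    -- the holomorphic continuation exists and is unique
    (∀ (a b c : ℂ) (d : ℝ), AffineMellin.Admissible a b d →
      (∃ F : ℂ → ℂ, AffineMellin.IsContinuation a b c d F) ∧
      (∀ F G : ℂ → ℂ, AffineMellin.IsContinuation a b c d F →
        AffineMellin.IsContinuation a b c d G → Set.EqOn F G (AffineMellin.domain a))) ∧
    -- the limit
    (∀ (s : ℂ) (d δ : ℝ), 0 < d → 0 < δ →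
      Tendsto
        (fun p : ℂ × ℂ => AffineMellin.tildeI s p.1 p.2 (1 / 4) d
          - (-Complex.I * AffineMellin.tildeI s p.1 p.2 0 d))
        (comap (fun p : ℂ × ℂ => d * p.1.im + p.2.im) atTop ⊓
          𝓟 {p : ℂ × ℂ | AffineMellin.Admissible p.1 p.2 d ∧
            s ∈ AffineMellin.domain p.1 ∧ δ ≤ ‖p.1‖})
        (𝓝 0)) ∧
    -- the exponential rate
    (∀ (s : ℂ) (δ : ℝ), 0 < δ → ∃ C : ℝ, ∀ (a b : ℂ) (d : ℝ),
      AffineMellin.Admissible a b d → s ∈ AffineMellin.domain a → δ ≤ d * ‖a‖ →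
      0 < d * a.im + b.im →
      ‖AffineMellin.tildeI s a b (1 / 4) d - (-Complex.I * AffineMellin.tildeI s a b 0 d)‖
        ≤ C * d ^ (-s.re) * Real.exp (-2 * Real.pi * (d * a.im + b.im))) := by
  refine ⟨fun a b c d h => ?_, fun s d δ hd hδ => ?_, fun s δ hδ => ?_⟩
  · exact ⟨⟨_, AffineMellin.isContinuation_continuedI h c⟩, fun F G hF hG => hF.eqOn hG⟩
  · exact AffineMellin.tendsto_tildeI_quarter_sub s hd hδ
  · obtain ⟨C, hC⟩ := AffineMellin.norm_tildeI_quarter_sub_le s hδ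
    exact ⟨C, fun a b d h hs hδa _ => hC a b d h hs hδa⟩
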